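/- **Presburger arithmetic with threshold quantifiers.** Linear terms are expressions $t = a_1x_1+\dots+a_dx_d+c$ with variables $x_i$ ranging over $\mathbb Z$ and $a_i,c\in\mathbb Z$; $t$ is homogeneous if $c=0$. Formulae are built from linear inequalities $t<0$ and modulo constraints $t\equiv 0 \bmod q$ ($q\ge 1$) by means of $\wedge$, $\neg$, the first-order quantifier $\exists y$ over $\mathbb Z$, and the threshold quantifiers $\exists^{\ge c}y$ with $c\in\mathbb Z$, where $\exists^{\ge c}y\,\psi$ holds under an assignment iff at least $c$ (possibly infinitely many) integer values of $y$ make $\psi$ true. Two formulae are equivalent if they are satisfied by the same assignments of integers to variables. For a formula $\varphi$, let $|\varphi|$ be its length, i.e. the number of symbols needed to write it, with numbers in binary. Let $\mathrm{lin}(\varphi)$ be the set of linear terms $t$ that appear in a linear inequality $t<0$ of $\varphi$, let $\mathrm{hom}(\varphi)$ be the set of homogeneous terms obtained from the terms of $\mathrm{lin}(\varphi)$ by replacing their constants by $0$, and let $\mathrm{mod}(\varphi)$ be the set consisting of $1$ and of all moduli $q$ of modulo constraints of $\varphi$. For a term $t$, $\|t\|_\infty$ is the maximal absolute value of a coefficient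 or of the constant of $t$; for a finite set $T$ of terms or of integers, $\|T\|_\infty$ is the maximum of $\|t\|_\infty$, respectively $|t|$, over $t\in T$ (and $0$ if $T=\emptyset$). **Lemma.** There is a constant $C$ such that every formula $\varphi$ of Presburger arithmetic with threshold quantifiers has an equivalent quantifier-free formula $\Phi$ for which - $|\mathrm{lin}(\Phi)|$, $\|\mathrm{lin}(\Phi)\|_\infty$, $\|\mathrm{hom}(\Phi)\|_\infty$ and $\|\mathrm{mod}(\Phi)\|_\infty$ are each at most $2^{2^{2^{C|\varphi|^2}}}$; - $|\mathrm{hom}(\Phi)| \le 2^{2^{C|\varphi|^2}}$ and $|\mathrm{mod}(\Phi)|\le|\varphi|$. (Here $|S|$ also denotes the cardinality of a finite set $S$.) -/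

import Mathlib

namespace ThresholdPA

/-- First-order variables: a fixed countably infinite set. -/
abbrev Var : Type := ℕ

/-- An assignment gives an integer value to every variable. -/
abbrev Assignment : Type := Var → ℤ

/-- A linear term `a₁ x₁ + ⋯ + a_d x_d + c` with integer coefficients and integer constant `c`.
Variables outside the support of `coeff` have coefficient `0`. -/
@[ext]
structure LinTerm where
  coeff : Var →₀ ℤ
  const : ℤ
deriving DecidableEq

namespace LinTerm

/-- The value of a term under an assignment. -/
def eval (ν : Assignment) (t : LinTerm) : ℤ :=
  (t.coeff.sum fun x a => a * ν x) + t.const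

/-- The homogeneous term obtained by setting the constant to `0`. -/
def hom (t : LinTerm) : LinTerm := ⟨t.coeff, 0⟩

/-- The largest absolute value of a coefficient or of the constant. -/
def norm (t : LinTerm) : ℕ :=
  max (t.coeff.support.sup fun x => (t.coeff x).natAbs) t.const.natAbs

end LinTerm

/-- The largest norm of a term in a finite set of terms (`0` for the empty set). -/
def termsNorm (T : Finset LinTerm) : ℕ := T.sup LinTerm.norm

/-- The largest element of a finite set of natural numbers (`0` for the empty set). -/
def natsNorm (S : Finset ℕ) : ℕ := S.sup id

/-- Formulae of Presburger arithmetic with threshold quantifiers. -/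
inductive Formula where
  /-- the linear inequality `t < 0` -/
  | ltZero (t : LinTerm) : Formula
  /-- the modulo constraint `t ≡ 0 mod q`, with `q ≥ 1` -/
  | modZero (t : LinTerm) (q : ℕ+) : Formula
  /-- conjunction -/
  | and (φ ψ : Formula) : Formula
  /-- negation -/
  | not (φ : Formula) : Formula
  /-- the first-order quantifier `∃ y, φ` over the integers -/
  | ex (y : Var) (φ : Formula) : Formula
  /-- the threshold quantifier `∃^{≥ c} y, φ` -/
  | exGe (c : ℤ) (y : Var) (φ : Formula) : Formula

namespace Formula

/-- Satisfaction of a formula by an assignment. For the threshold quantifier, the number of witnesses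
may be infinite, and every threshold `c ≤ 0` is met. -/
def Sat : Formula → Assignment → Prop
  | ltZero t, ν => t.eval ν < 0
  | modZero t q, ν => ((q : ℕ) : ℤ) ∣ t.eval ν
  | and φ ψ, ν => φ.Sat ν ∧ ψ.Sat ν
  | not φ, ν => ¬ φ.Sat ν
  | ex y φ, ν => ∃ n : ℤ, φ.Sat (Function.update ν y n)
  | exGe c y φ, ν => (c.toNat : ℕ∞) ≤ {n : ℤ | φ.Sat (Function.update ν y n)}.encard

/-- Two formulae are equivalent if the same assignments satisfy them. -/
def Equivalent (φ ψ : Formula) : Prop := ∀ ν : Assignment, φ.Sat ν ↔ ψ.Sat ν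

/-- Formulae without any quantifier. -/
def QuantifierFree : Formula → Prop
  | ltZero _ => True
  | modZero _ _ => True
  | and φ ψ => φ.QuantifierFree ∧ ψ.QuantifierFree
  | not φ => φ.QuantifierFree
  | ex _ _ => False
  | exGe _ _ _ => False

/-- The linear terms `t` that appear in a linear inequality `t < 0` of the formula. -/
def linTerms : Formula → Finset LinTerm
  | ltZero t => {t}
  | modZero _ _ => ∅
  | and φ ψ => φ.linTerms ∪ ψ.linTerms
  | not φ => φ.linTerms
  | ex _ φ => φ.linTerms
  | exGe _ _ φ => φ.linTerms

/-- The homogeneous terms obtained from `linTerms` by setting all constants to `0`. -/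
def homTerms (φ : Formula) : Finset LinTerm := φ.linTerms.image LinTerm.hom

/-- The moduli of the modulo constraints of the formula, together with `1`. -/
def moduli : Formula → Finset ℕ
  | ltZero _ => {1}
  | modZero _ q => {1, (q : ℕ)}
  | and φ ψ => φ.moduli ∪ ψ.moduli
  | not φ => φ.moduli
  | ex _ φ => φ.moduli
  | exGe _ _ φ => φ.moduli

end Formula

/-- The number of binary digits of a natural number; `0` is written with one digit. -/
def natLength (n : ℕ) : ℕ := max 1 n.size

/-- The number of symbols of an integer in binary: a possible minus sign, and the digits. -/
def intLength (a : ℤ) : ℕ := (if a < 0 then 1 else 0) + natLength a.natAbs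

/-- The number of symbols of `a₁ x₁ + ⋯ + a_d x_d + c`: each summand `a x +` takes the length of `a`,
one symbol for the variable and one for `+`. -/
def LinTerm.length (t : LinTerm) : ℕ :=
  (∑ x ∈ t.coeff.support, (intLength (t.coeff x) + 2)) + intLength t.const

/-- The number of symbols of a formula, with numbers in binary; variables, connectives, quantifier and
relation symbols count as one symbol each. -/
def Formula.length : Formula → ℕ
  | .ltZero t => t.length + 2
  | .modZero t q => t.length + 3 + natLength (q : ℕ)
  | .and φ ψ => φ.length + ψ.length + 1
  | .not φ => φ.length + 1
  | .ex _ φ => φ.length + 2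
  | .exGe c _ φ => intLength c + φ.length + 3

end ThresholdPA

namespace ThresholdPA

/-! The quantifiers are eliminated semantically. By induction on the formula, its truth depends only
on the residues of finitely many variables mod `m` and on the values, cut off at `±K`, of finitely
many linear forms (`Determined`). A formula is written down only once, at the end
(`Determined.exists_formula`), so `Φ` needs a single modulus besides `1`.

The quantifier case is `Determined.exGe`. Each form `h` with `h y ≠ 0` contributes its root in `y`
as a breakpoint. Take two assignments whose breakpoints have the same differences up to a cutoff and
are congruent in the sense that corresponding ones differ by multiples of `m`. If some witness is
far from all breakpoints, its gap is long enough in both assignments to hold `c` witnesses.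
Otherwise every witness is near a breakpoint and can be carried along with it, injectively. Either
way "at least `c` witnesses" transfers (`le_encard_transfer`).

One elimination squares the number of forms and their coefficients `A`, up to constants, and
multiplies `m` by `A!`. Iteration makes the former doubly and the latter triply exponential
(`BoundedDetermined.exGe`). -/

/-- Two numbers are equal, or both exceed `K`, or both lie below `-K`. -/
def ClampEq {R : Type*} [Ring R] [LinearOrder R] (K x y : R) : Prop :=
  x = y ∨ (K < x ∧ K < y) ∨ (x < -K ∧ y < -K)

lemma ClampEq.symm {R : Type*} [Ring R] [LinearOrder R] {K x y : R} (h : ClampEq K x y) :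
    ClampEq K y x := by
  rcases h with h | h | h
  · exact Or.inl h.symm
  · exact Or.inr (Or.inl h.symm)
  · exact Or.inr (Or.inr h.symm)

lemma ClampEq.mono {R : Type*} [CommRing R] [LinearOrder R] [IsStrictOrderedRing R] {K L x y : R}
    (hKL : K ≤ L) (h : ClampEq L x y) : ClampEq K x y := by
  rcases h with h | ⟨h, h'⟩ | ⟨h, h'⟩
  · exact Or.inl h
  · exact Or.inr (Or.inl ⟨by linarith, by linarith⟩)
  · exact Or.inr (Or.inr ⟨by linarith, by linarith⟩)

/-! ### Counting integers relative to moving breakpoints -/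

/-- If a property holds at an integer far from all breakpoints, then the corresponding property
holds at `c` integers in the corresponding gap. -/
lemma le_encard_of_far {ι : Type*} (s : Finset ι) (b b' : ι → ℚ) (P' : ℤ → Prop) (m c : ℕ)
    (K D : ℚ) (hK : 0 ≤ K) (hm : 0 < m) (hD : K + m * c ≤ D)
    (hd : ∀ i ∈ s, ∃ d : ℤ, b' i - b i = m * d)
    (hB : ∀ i ∈ s, ∀ j ∈ s, ClampEq (2 * D) (b i - b j) (b' i - b' j))
    (n : ℤ) (hn : ∀ i ∈ s, D < |n - b i|)
    (hP : ∀ n' : ℤ, (m : ℤ) ∣ n - n' → (∀ i ∈ s, ClampEq K (n - b i) (n' - b' i)) → P' n') :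
    (c : ℕ∞) ≤ {n | P' n}.encard := by
  have hm' : (0 : ℚ) < m := by exact_mod_cast hm
  have key : ∃ n₀ e : ℤ, e ≠ 0 ∧ ∀ j < c, P' (n₀ + e * (m * j)) := by
    rcases s.eq_empty_or_nonempty with rfl | hs
    · exact ⟨n, 1, one_ne_zero, fun j _ => hP _ ⟨-j, by ring⟩ (by simp)⟩
    obtain ⟨i, hi, hmin⟩ := s.exists_min_image (fun i => |n - b i|) hs
    obtain ⟨d, hd⟩ := hd i hi
    obtain ⟨e, he, hx⟩ : ∃ e : ℤ, (e = 1 ∨ e = -1) ∧ |n - b i| = e * (n - b i) := by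
      rcases abs_choice ((n : ℚ) - b i) with h | h
      · exact ⟨1, Or.inl rfl, by rw [h]; simp⟩
      · exact ⟨-1, Or.inr rfl, by rw [h]; simp⟩
    set x : ℚ := |n - b i| with hxdef
    have hDx : D < x := hn i hi
    -- Slide towards the nearest breakpoint `b i` in steps of `m`, stopping just outside distance
    -- `K`.
    obtain ⟨t, ht1, ht2⟩ : ∃ t : ℤ, K < x - m * t ∧ x - m * t ≤ K + m := by
      refine ⟨⌈(x - K) / m⌉ - 1, ?_, ?_⟩
      · have h := Int.ceil_lt_add_one ((x - K) / m)
        have h2 : ((⌈(x - K) / m⌉ - 1 : ℤ) : ℚ) < (x - K) / m := by push_cast; linarith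
        rw [lt_div_iff₀ hm'] at h2
        linarith
      · have h := Int.le_ceil ((x - K) / m)
        rw [div_le_iff₀ hm'] at h
        push_cast
        linarith
    -- The `j`-th witness is `b' i + e * (x - m * t + m * j)`, at distance more than `K` and at most
    -- `K + m * c ≤ D` from `b' i`. Since `b i` is nearest to `n`, breakpoints on its side are no
    -- closer to the witness than `b' i`. Those on the other side are more than `2 * D` from `b i`,
    -- hence from `b' i`, so they stay more than `K` away.
    refine ⟨n + m * d - e * (m * t), e, by rcases he with rfl | rfl <;> simp, fun j hj => ?_⟩
    refine hP _ ⟨-d + e * t - e * j, by ring⟩ fun g hg => ?_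
    have hj1 : (m : ℚ) * j + m ≤ m * c := by
      have : (j : ℚ) + 1 ≤ c := by exact_mod_cast hj
      nlinarith
    have hj0 : (0 : ℚ) ≤ m * j := by positivity
    have hg1 := hmin g hg
    have hgB := hB g hg i hi
    push_cast
    rcases he with rfl | rfl
    · push_cast at hx ⊢
      rcases le_abs'.1 hg1 with h | h
      · right; right
        rcases hgB with hh | hh | hh <;> constructor <;> linarith
      · right; left
        rcases hgB with hh | hh | hh <;> constructor <;> linarith
    · push_cast at hx ⊢
      rcases le_abs'.1 hg1 with h | h
      · right; right
        rcases hgB with hh | hh | hh <;> constructor <;> linarith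
      · right; left
        rcases hgB with hh | hh | hh <;> constructor <;> linarith
  obtain ⟨n₀, e, he, h⟩ := key
  have hinj : Function.Injective fun j : ℕ => n₀ + e * (m * (j : ℤ)) := by
    intro j k hjk
    simpa [he, hm.ne'] using hjk
  have hsub : (((Finset.range c).image fun j : ℕ => n₀ + e * (m * (j : ℤ)) : Finset ℤ) : Set ℤ) ⊆
      {n | P' n} := by
    intro z hz
    simp only [Finset.coe_image, Set.mem_image, Finset.coe_range, Set.mem_Iio] at hz
    obtain ⟨j, hj, rfl⟩ := hz
    exact h j hj
  calc (c : ℕ∞) = _ := by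
        rw [Set.encard_coe_eq_coe_finsetCard, Finset.card_image_of_injective _ hinj,
          Finset.card_range]
    _ ≤ _ := Set.encard_le_encard hsub

/-- If all integers with a property are near a breakpoint, they can be moved along with the
breakpoints. -/
lemma encard_le_encard_of_near {ι : Type*} (s : Finset ι) (b b' : ι → ℚ) (P P' : ℤ → Prop)
    (m : ℕ) (K D : ℚ) (hKD : K ≤ D)
    (hd : ∀ i ∈ s, ∃ d : ℤ, b' i - b i = m * d)
    (hB : ∀ i ∈ s, ∀ j ∈ s, ClampEq (2 * D) (b i - b j) (b' i - b' j))
    (hn : ∀ n : ℤ, P n → ∃ i ∈ s, |n - b i| ≤ D)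
    (hP : ∀ n n' : ℤ, (m : ℤ) ∣ n - n' → (∀ i ∈ s, ClampEq K (n - b i) (n' - b' i)) →
      P n → P' n') :
    {n | P n}.encard ≤ {n | P' n}.encard := by
  have key : ∀ n : ℤ, ∃ n' : ℤ, P n →
      P' n' ∧ ∃ i ∈ s, |n - b i| ≤ D ∧ (n' : ℚ) - b' i = n - b i := by
    intro n
    by_cases h : P n
    · obtain ⟨i, hi, hni⟩ := hn n h
      obtain ⟨d, hd⟩ := hd i hi
      -- The shift keeps the offset from the `i`-th breakpoint. A breakpoint more than `2 * D` from
      -- it remains more than `D ≥ K` from the image.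
      refine ⟨n + m * d, fun _ => ⟨hP n _ ⟨-d, by ring⟩ (fun g hg => ?_) h, i, hi, hni, ?_⟩⟩
      · have := abs_le.1 hni
        push_cast
        rcases hB i hi g hg with hh | hh | hh
        · left; linarith
        · right; left; constructor <;> linarith
        · right; right; constructor <;> linarith
      · push_cast; linarith
    · exact ⟨0, fun h' => absurd h' h⟩
  choose f hf using key
  refine Set.encard_le_encard_of_injOn (f := f) (fun n hn => (hf n hn).1) ?_
  intro n₁ h₁ n₂ h₂ he
  obtain ⟨-, i, hi, hni, hfi⟩ := hf n₁ h₁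
  obtain ⟨-, j, hj, hnj, hfj⟩ := hf n₂ h₂
  have e : (f n₁ : ℚ) = f n₂ := by exact_mod_cast he
  have a1 := abs_le.1 hni
  have a2 := abs_le.1 hnj
  -- Equal images put `b' i` and `b' j` within `2 * D` of each other, where the clamped differences
  -- agree exactly; this is what the factor `2` is for.
  have : (n₁ : ℚ) = n₂ := by
    rcases hB i hi j hj with hh | hh | hh <;> linarith
  exact_mod_cast this

/-- Comparison of the numbers of integers satisfying two properties that are governed by
similarly ordered breakpoints. -/
lemma le_encard_transfer {ι : Type*} (s : Finset ι) (b b' : ι → ℚ) (P P' : ℤ → Prop)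
    (m c : ℕ) (K : ℚ) (hK : 0 ≤ K) (hm : 0 < m)
    (hd : ∀ i ∈ s, ∃ d : ℤ, b' i - b i = m * d)
    (hB : ∀ i ∈ s, ∀ j ∈ s, ClampEq (2 * (K + m * c)) (b i - b j) (b' i - b' j))
    (hP : ∀ n n' : ℤ, (m : ℤ) ∣ n - n' → (∀ i ∈ s, ClampEq K (n - b i) (n' - b' i)) →
      P n → P' n')
    (hc : (c : ℕ∞) ≤ {n | P n}.encard) : (c : ℕ∞) ≤ {n | P' n}.encard := by
  by_cases h : ∃ n : ℤ, P n ∧ ∀ i ∈ s, K + m * c < |n - b i|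
  · obtain ⟨n, hn, hfar⟩ := h
    exact le_encard_of_far s b b' P' m c K _ hK hm le_rfl hd hB n hfar
      fun n' h1 h2 => hP n n' h1 h2 hn
  · push Not at h
    exact hc.trans (encard_le_encard_of_near s b b' P P' m K _
      (le_add_of_nonneg_right (by positivity)) hd hB h hP)

/-! ### Linear forms, determined properties and quantifier elimination -/

/-- The value of a linear form. -/
def formEval (ν : Assignment) (h : Var →₀ ℤ) : ℤ := h.sum fun x a => a * ν x

lemma formEval_add (ν : Assignment) (g h : Var →₀ ℤ) :
    formEval ν (g + h) = formEval ν g + formEval ν h :=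
  Finsupp.sum_add_index' (by simp) (by intros; ring)

lemma formEval_smul (ν : Assignment) (a : ℤ) (h : Var →₀ ℤ) :
    formEval ν (a • h) = a * formEval ν h := by
  unfold formEval
  rw [Finsupp.sum_smul_index (by simp), Finsupp.mul_sum]
  simp only [mul_assoc]

lemma formEval_single (ν : Assignment) (x : Var) (a : ℤ) :
    formEval ν (Finsupp.single x a) = a * ν x := by
  simp [formEval]

lemma formEval_erase_update (ν : Assignment) (h : Var →₀ ℤ) (y : Var) (n : ℤ) :
    formEval (Function.update ν y n) (h.erase y) = formEval ν (h.erase y) := by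
  unfold formEval
  refine Finsupp.sum_congr fun x hx => ?_
  have : x ≠ y := by rintro rfl; simp at hx
  simp [this]

lemma formEval_update (ν : Assignment) (h : Var →₀ ℤ) (y : Var) (n : ℤ) :
    formEval (Function.update ν y n) h = h y * n + formEval ν (h.erase y) := by
  conv_lhs => rw [← Finsupp.single_add_erase y h]
  rw [formEval_add, formEval_single, formEval_erase_update]
  simp

lemma dvd_formEval_sub {m : ℤ} {ν ν' : Assignment} {h : Var →₀ ℤ}
    (hν : ∀ x ∈ h.support, m ∣ ν x - ν' x) : m ∣ formEval ν h - formEval ν' h := by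
  unfold formEval Finsupp.sum
  rw [← Finset.sum_sub_distrib]
  refine Finset.dvd_sum fun x hx => ?_
  rw [← mul_sub]
  exact (hν x hx).mul_left _

/-- The truth of `P` only depends on the residues mod `m` of the variables in `V`, and on the
values, cut off at `±K`, of the linear forms in `H`. -/
def Determined (V : Finset Var) (H : Finset (Var →₀ ℤ)) (K m : ℕ) (P : Assignment → Prop) : Prop :=
  ∀ ν ν' : Assignment, (∀ x ∈ V, (m : ℤ) ∣ ν x - ν' x) →
    (∀ h ∈ H, ClampEq (K : ℤ) (formEval ν h) (formEval ν' h)) → P ν → P ν'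

lemma Determined.mono {V V' : Finset Var} {H H' : Finset (Var →₀ ℤ)} {K K' m m' : ℕ}
    {P : Assignment → Prop} (hP : Determined V H K m P) (hV : V ⊆ V') (hH : H ⊆ H')
    (hK : K ≤ K') (hm : m ∣ m') : Determined V' H' K' m' P := fun ν ν' h1 h2 =>
  hP ν ν' (fun x hx => (Int.natCast_dvd_natCast.2 hm).trans (h1 x (hV hx)))
    (fun h hh => (h2 h (hH hh)).mono (by exact_mod_cast hK))

lemma Determined.not {V : Finset Var} {H : Finset (Var →₀ ℤ)} {K m : ℕ}
    {P : Assignment → Prop} (hP : Determined V H K m P) : Determined V H K m fun ν => ¬ P ν :=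
  fun ν ν' h1 h2 h => mt (hP ν' ν (fun x hx => (dvd_sub_comm).1 (h1 x hx))
    (fun g hg => (h2 g hg).symm)) h

/-- The linear forms that arise from those in `H` by eliminating the variable `y`. -/
noncomputable def elimForms (y : Var) (H : Finset (Var →₀ ℤ)) : Finset (Var →₀ ℤ) :=
  H.image (Finsupp.erase y) ∪
    (H ×ˢ H).image fun p => p.1 y • p.2.erase y + (-p.2 y) • p.1.erase y

lemma card_elimForms_le (y : Var) (H : Finset (Var →₀ ℤ)) :
    (elimForms y H).card ≤ H.card + H.card ^ 2 := by
  refine (Finset.card_union_le _ _).trans (add_le_add Finset.card_image_le ?_)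
  exact Finset.card_image_le.trans (by rw [Finset.card_product, sq])

lemma natAbs_elimForms_le {y : Var} {H : Finset (Var →₀ ℤ)} {A : ℕ}
    (hA : ∀ h ∈ H, ∀ x, (h x).natAbs ≤ A) :
    ∀ h ∈ elimForms y H, ∀ x, (h x).natAbs ≤ A + 2 * A ^ 2 := by
  have herase : ∀ h ∈ H, ∀ x, (h.erase y x).natAbs ≤ A := by
    intro h hh x
    rw [Finsupp.erase_apply]
    split_ifs
    · simp
    · exact hA h hh x
  intro h hh x
  rcases Finset.mem_union.1 hh with hh | hh
  · obtain ⟨g, hg, rfl⟩ := Finset.mem_image.1 hh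
    exact (herase g hg x).trans (Nat.le_add_right _ _)
  · obtain ⟨⟨f, g⟩, hfg, rfl⟩ := Finset.mem_image.1 hh
    obtain ⟨hf, hg⟩ := Finset.mem_product.1 hfg
    have h1 := Nat.mul_le_mul (hA f hf y) (herase g hg x)
    have h2 := Nat.mul_le_mul (hA g hg y) (herase f hf x)
    have h3 := Int.natAbs_add_le (f y * g.erase y x) (-g y * f.erase y x)
    simp only [Int.natAbs_mul, Int.natAbs_neg] at h3
    simp only [Finsupp.add_apply, Finsupp.smul_apply, smul_eq_mul]
    nlinarith

/-- Undoes the clearing of denominators: dividing by `a` shrinks the cutoff by at most `A`, and a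
negative `a` swaps the two unbounded cases. -/
lemma ClampEq.of_mul {a K w w' : ℚ} {x x' : ℚ} (hK : 0 ≤ K) (ha : a ≠ 0) {A : ℚ} (haA : |a| ≤ A)
    (hw : w = a * x) (hw' : w' = a * x') (h : ClampEq (A * K) w w') : ClampEq K x x' := by
  subst hw hw'
  have hA : 0 < |a| := abs_pos.2 ha
  have hAK : |a| * K ≤ A * K := mul_le_mul_of_nonneg_right haA hK
  rcases h with h | ⟨h, h'⟩ | ⟨h, h'⟩
  · exact Or.inl (mul_left_cancel₀ ha h)
  · rcases ha.lt_or_gt with h0 | h0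
    · rw [abs_of_neg h0] at hAK
      right; right; constructor <;> nlinarith
    · rw [abs_of_pos h0] at hAK
      right; left; constructor <;> nlinarith
  · rcases ha.lt_or_gt with h0 | h0
    · rw [abs_of_neg h0] at hAK
      right; left; constructor <;> nlinarith
    · rw [abs_of_pos h0] at hAK
      right; right; constructor <;> nlinarith

lemma ClampEq.mul_left {a K x x' : ℚ} (hK : 0 ≤ K) (ha : 1 ≤ |a|)
    (h : ClampEq K x x') : ClampEq K (a * x) (a * x') := by
  rcases h with h | ⟨h, h'⟩ | ⟨h, h'⟩
  · exact Or.inl (by rw [h])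
  · rcases le_abs.1 ha with h0 | h0
    · right; left; constructor <;> nlinarith
    · right; right; constructor <;> nlinarith
  · rcases le_abs.1 ha with h0 | h0
    · right; right; constructor <;> nlinarith
    · right; left; constructor <;> nlinarith

lemma ClampEq.intCast_iff {K x y : ℤ} : ClampEq (K : ℚ) x y ↔ ClampEq K x y := by
  unfold ClampEq
  norm_cast

/-- Elimination of a threshold quantifier. -/
lemma Determined.exGe {V : Finset Var} {H : Finset (Var →₀ ℤ)} {K m A : ℕ}
    {P : Assignment → Prop} (hP : Determined V H K m P) (hm : 0 < m)
    (hA : ∀ h ∈ H, ∀ x, (h x).natAbs ≤ A) (c : ℕ) (y : Var) :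
    Determined (V ∪ H.biUnion Finsupp.support) (elimForms y H)
      (K + A ^ 2 * (2 * (K + m * c))) (m * A.factorial)
      fun ν => (c : ℕ∞) ≤ {n : ℤ | P (Function.update ν y n)}.encard := by
  intro ν ν' hν hH
  have hKq : (0 : ℚ) ≤ K := by positivity
  -- The breakpoint of `h` is the root in `y` of `h y * y + formEval ν (h.erase y)`.
  refine le_encard_transfer (H.filter fun h => h y ≠ 0)
    (fun h => -(formEval ν (h.erase y) : ℚ) / h y) (fun h => -(formEval ν' (h.erase y) : ℚ) / h y)
    _ _ m c K hKq hm ?_ ?_ ?_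
  · intro h hh
    obtain ⟨hh, hy⟩ := Finset.mem_filter.1 hh
    have hdvd : (m : ℤ) * h y ∣ formEval ν (h.erase y) - formEval ν' (h.erase y) := by
      refine dvd_formEval_sub fun x hx => dvd_trans ?_ (hν x ?_)
      -- `A!` is a common multiple of all nonzero `h y`, so congruence mod `m * A!` survives
      -- division by `h y` as congruence mod `m`.
      · push_cast
        refine mul_dvd_mul_left _ ?_
        rw [← Int.natAbs_dvd]
        exact Int.natCast_dvd_natCast.2
          (Nat.dvd_factorial (Int.natAbs_pos.2 hy) (hA h hh y))
      · refine Finset.mem_union_right _ (Finset.mem_biUnion.2 ⟨h, hh, ?_⟩)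
        rw [Finsupp.support_erase] at hx
        exact Finset.mem_of_mem_erase hx
    obtain ⟨d, hd⟩ := hdvd
    refine ⟨d, ?_⟩
    have hd' : (formEval ν (h.erase y) : ℚ) - formEval ν' (h.erase y) = m * h y * d := by
      exact_mod_cast hd
    have hy' : (h y : ℚ) ≠ 0 := by exact_mod_cast hy
    field_simp
    linarith
  · intro f hf g hg
    obtain ⟨hf, hfy⟩ := Finset.mem_filter.1 hf
    obtain ⟨hg, hgy⟩ := Finset.mem_filter.1 hg
    have hfy' : (f y : ℚ) ≠ 0 := by exact_mod_cast hfy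
    have hgy' : (g y : ℚ) ≠ 0 := by exact_mod_cast hgy
    -- This form takes the value `f y * g y` times the difference of the breakpoints of `f` and `g`;
    -- as `|f y * g y| ≤ A ^ 2`, its cutoff carries a factor `A ^ 2`.
    have h1 := hH (f y • g.erase y + (-g y) • f.erase y) (Finset.mem_union_right _
      (Finset.mem_image.2 ⟨(f, g), Finset.mem_product.2 ⟨hf, hg⟩, rfl⟩))
    have h2 := ClampEq.intCast_iff.2 (h1.mono (K := ((A ^ 2 * (2 * (K + m * c)) : ℕ) : ℤ))
      (by push_cast; linarith))
    simp only [formEval_add, formEval_smul] at h2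
    push_cast at h2
    refine h2.of_mul (a := f y * g y) (by positivity) (mul_ne_zero hfy' hgy') ?_ ?_ ?_
    · rw [abs_mul, sq]
      have hc : ∀ z : ℤ, z.natAbs ≤ A → |(z : ℚ)| ≤ A := fun z hz => by
        rw [← Int.cast_abs, Int.abs_eq_natAbs]
        exact_mod_cast hz
      exact mul_le_mul (hc _ (hA f hf y)) (hc _ (hA g hg y)) (abs_nonneg _) (by positivity)
    · field_simp
      ring
    · field_simp
      ring
  · intro n n' hn hs
    refine hP _ _ (fun x hx => ?_) fun h hh => ?_
    · by_cases hxy : x = y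
      · subst hxy; simpa using hn
      · simp only [Function.update_of_ne hxy]
        exact (Dvd.intro _ (by push_cast; rfl)).trans (hν x (Finset.mem_union_left _ hx))
    · rw [formEval_update, formEval_update]
      by_cases hy : h y = 0
      · simp only [hy, zero_mul, zero_add]
        exact (hH _ (Finset.mem_union_left _ (Finset.mem_image_of_mem _ hh))).mono
          (by push_cast; nlinarith [show (0 : ℤ) ≤ A ^ 2 * (2 * (K + m * c)) by positivity])
      · have hy' : (h y : ℚ) ≠ 0 := by exact_mod_cast hy
        -- The value of `h` at `y = n` is `h y` times the distance of `n` from the breakpoint, and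
        -- `|h y| ≥ 1` does not lower the cutoff.
        have h1 := (hs h (Finset.mem_filter.2 ⟨hh, hy⟩)).mul_left (a := h y) hKq (by
          rw [← Int.cast_abs]; exact_mod_cast Int.one_le_abs hy)
        rw [← ClampEq.intCast_iff]
        convert h1 using 1 <;> push_cast <;> field_simp <;> ring

/-! ### From determined properties to quantifier-free formulae -/

/-- A property that is a function of the truth values of finitely many quantifier-free formulae is
expressed by a Boolean combination of them. -/
lemma exists_boolean_combination {L : Finset LinTerm} {M : Finset ℕ} (hM : 1 ∈ M)
    (atoms : List Formula)
    (hatoms : ∀ α ∈ atoms, α.QuantifierFree ∧ α.linTerms ⊆ L ∧ α.moduli ⊆ M)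
    (P : Assignment → Prop)
    (hP : ∀ ν ν' : Assignment, (∀ α ∈ atoms, α.Sat ν ↔ α.Sat ν') → P ν → P ν') :
    ∃ Φ : Formula, Φ.QuantifierFree ∧ Φ.linTerms ⊆ L ∧ Φ.moduli ⊆ M ∧ ∀ ν, Φ.Sat ν ↔ P ν := by
  induction atoms generalizing P with
  | nil =>
    have htrue : ∀ ν, (Formula.modZero ⟨0, 0⟩ 1).Sat ν := fun ν => by simp [Formula.Sat]
    by_cases h : ∃ ν, P ν
    · obtain ⟨ν₀, h₀⟩ := h
      exact ⟨.modZero ⟨0, 0⟩ 1, trivial, by simp [Formula.linTerms], by simpa [Formula.moduli] using hM,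
        fun ν => iff_of_true (htrue ν) (hP ν₀ ν (by simp) h₀)⟩
    · exact ⟨.not (.modZero ⟨0, 0⟩ 1), trivial, by simp [Formula.linTerms],
        by simpa [Formula.moduli] using hM,
        fun ν => iff_of_false (not_not_intro (htrue ν)) (fun h' => h ⟨ν, h'⟩)⟩
  | cons α l ih =>
    obtain ⟨⟨hq, hL, hM'⟩, hl⟩ := List.forall_mem_cons.1 hatoms
    -- Shannon expansion on `α`. Quantifying over assignments that agree on `l` makes each cofactor
    -- depend on `l` alone, as the induction hypothesis requires.
    have step : ∀ Q : Assignment → Prop, ∃ Φ : Formula, Φ.QuantifierFree ∧ Φ.linTerms ⊆ L ∧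
        Φ.moduli ⊆ M ∧ ∀ ν, Φ.Sat ν ↔ ∃ ν', (∀ β ∈ l, β.Sat ν' ↔ β.Sat ν) ∧ Q ν' ∧ P ν' := by
      intro Q
      refine ih hl _ ?_
      rintro ν ν' h ⟨ν₁, h₁, h₂⟩
      exact ⟨ν₁, fun β hβ => (h₁ β hβ).trans (h β hβ), h₂⟩
    obtain ⟨Φ₁, q₁, l₁, m₁, h₁⟩ := step α.Sat
    obtain ⟨Φ₂, q₂, l₂, m₂, h₂⟩ := step fun ν => ¬ α.Sat ν
    refine ⟨.not (.and (.not (.and α Φ₁)) (.not (.and (.not α) Φ₂))), ⟨⟨hq, q₁⟩, hq, q₂⟩, ?_, ?_,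
      fun ν => ?_⟩
    · simp [Formula.linTerms, Finset.union_subset_iff, *]
    · simp [Formula.moduli, Finset.union_subset_iff, *]
    · simp only [Formula.Sat, h₁, h₂]
      constructor
      · intro h
        by_contra hn
        refine h ⟨?_, ?_⟩
        · rintro ⟨ha, ν', hβ, ha', hp⟩
          exact hn (hP ν' ν (List.forall_mem_cons.2 ⟨iff_of_true ha' ha, hβ⟩) hp)
        · rintro ⟨ha, ν', hβ, ha', hp⟩
          exact hn (hP ν' ν (List.forall_mem_cons.2 ⟨iff_of_false ha' ha, hβ⟩) hp)
      · rintro hp ⟨ha, hb⟩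
        by_cases h : α.Sat ν
        · exact ha ⟨h, ν, fun _ _ => Iff.rfl, h, hp⟩
        · exact hb ⟨h, ν, fun _ _ => Iff.rfl, h, hp⟩

lemma eval_eq_formEval (ν : Assignment) (t : LinTerm) :
    t.eval ν = formEval ν t.coeff + t.const := rfl

lemma clampEq_of_lt_iff {K x y : ℤ} (hK : 0 ≤ K)
    (h : ∀ k ∈ Finset.Icc (-(K + 1)) (K + 1), x + k < 0 ↔ y + k < 0) : ClampEq K x y := by
  unfold ClampEq
  have h1 := h (-(K + 1)) (by simp; omega)
  have h2 := h K (by simp; omega)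
  by_cases hx : -K ≤ x ∧ x ≤ K
  -- The shifts `-x` and `-x - 1` force `y ≥ x` and `y ≤ x`; at `x = K` the second reaches the end
  -- `-(K + 1)` of the range.
  · have h3 := h (-x) (by simp; omega)
    have h4 := h (-x - 1) (by simp; omega)
    omega
  · omega

/-- The terms with linear form in `H` and constant of absolute value at most `K + 1`. -/
noncomputable def boxTerms (H : Finset (Var →₀ ℤ)) (K : ℕ) : Finset LinTerm :=
  (H ×ˢ Finset.Icc (-(K + 1) : ℤ) (K + 1)).image fun p => ⟨p.1, p.2⟩

lemma mem_boxTerms {H : Finset (Var →₀ ℤ)} {K : ℕ} {t : LinTerm} :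
    t ∈ boxTerms H K ↔ t.coeff ∈ H ∧ t.const ∈ Finset.Icc (-(K + 1) : ℤ) (K + 1) := by
  rw [boxTerms, Finset.mem_image]
  constructor
  · rintro ⟨p, hp, rfl⟩
    exact Finset.mem_product.1 hp
  · exact fun h => ⟨(t.coeff, t.const), Finset.mem_product.2 h, rfl⟩

lemma card_boxTerms_le (H : Finset (Var →₀ ℤ)) (K : ℕ) :
    (boxTerms H K).card ≤ H.card * (2 * K + 3) := by
  refine Finset.card_image_le.trans ?_
  rw [Finset.card_product, Int.card_Icc]
  exact Nat.mul_le_mul_left _ (by omega)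

/-- A determined property is expressed by a quantifier-free formula. -/
lemma Determined.exists_formula {V : Finset Var} {H : Finset (Var →₀ ℤ)} {K m : ℕ}
    {P : Assignment → Prop} (hP : Determined V H K m P) (hm : 0 < m) :
    ∃ Φ : Formula, Φ.QuantifierFree ∧ Φ.linTerms ⊆ boxTerms H K ∧ Φ.moduli ⊆ {1, m} ∧
      ∀ ν, Φ.Sat ν ↔ P ν := by
  refine exists_boolean_combination (by simp)
    ((boxTerms H K).toList.map Formula.ltZero ++
      (V ×ˢ Finset.range m).toList.map fun p =>
        Formula.modZero ⟨Finsupp.single p.1 1, -(p.2 : ℤ)⟩ ⟨m, hm⟩) ?_ P ?_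
  · intro α hα
    rcases List.mem_append.1 hα with h | h
    · obtain ⟨t, ht, rfl⟩ := List.mem_map.1 h
      exact ⟨trivial, by simpa [Formula.linTerms] using ht, by simp [Formula.moduli]⟩
    · obtain ⟨p, -, rfl⟩ := List.mem_map.1 h
      exact ⟨trivial, by simp [Formula.linTerms], by simp [Formula.moduli]⟩
  · intro ν ν' h
    refine hP ν ν' (fun x hx => ?_) fun g hg => ?_
    · have hmZ : (m : ℤ) ≠ 0 := by exact_mod_cast hm.ne'
      have h0 := Int.emod_nonneg (ν x) hmZ
      have h1 := Int.emod_lt_of_pos (ν x) (show (0 : ℤ) < m by exact_mod_cast hm)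
      have hr : (((ν x % m).toNat : ℕ) : ℤ) = ν x % m := Int.toNat_of_nonneg h0
      have h2 := h (.modZero ⟨Finsupp.single x 1, -((ν x % m).toNat : ℤ)⟩ ⟨m, hm⟩)
        (List.mem_append_right _ (List.mem_map.2 ⟨(x, (ν x % m).toNat),
          Finset.mem_toList.2 (Finset.mem_product.2 ⟨hx, Finset.mem_range.2 (by omega)⟩), rfl⟩))
      simp only [Formula.Sat, eval_eq_formEval, formEval_single, hr, one_mul, PNat.mk_coe] at h2
      have h3 : (m : ℤ) ∣ ν x + -(ν x % m) := by
        rw [← sub_eq_add_neg]; exact Int.dvd_self_sub_emod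
      have h4 := dvd_sub h3 (h2.1 h3)
      simpa using h4
    · refine clampEq_of_lt_iff (by positivity) fun k hk => ?_
      exact h (.ltZero ⟨g, k⟩) (List.mem_append_left _ (List.mem_map.2 ⟨⟨g, k⟩,
        Finset.mem_toList.2 (mem_boxTerms.2 ⟨hg, hk⟩), rfl⟩))

/-! ### Size bounds in terms of formula length -/

lemma natAbs_lt_two_pow_intLength (a : ℤ) : a.natAbs < 2 ^ intLength a :=
  (Nat.lt_size_self _).trans_le (Nat.pow_le_pow_right (by norm_num)
    ((le_max_right _ _).trans (Nat.le_add_left _ _)))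

lemma LinTerm.intLength_const_le (t : LinTerm) : intLength t.const ≤ t.length :=
  Nat.le_add_left _ _

lemma LinTerm.natAbs_coeff_lt (t : LinTerm) (x : Var) : (t.coeff x).natAbs < 2 ^ t.length := by
  by_cases hx : x ∈ t.coeff.support
  · refine (natAbs_lt_two_pow_intLength _).trans_le (Nat.pow_le_pow_right (by norm_num) ?_)
    have := Finset.single_le_sum (f := fun x => intLength (t.coeff x) + 2)
      (fun _ _ => Nat.zero_le _) hx
    unfold LinTerm.length
    omega
  · rw [Finsupp.notMem_support_iff.1 hx]
    simp

lemma one_le_intLength (a : ℤ) : 1 ≤ intLength a :=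
  (le_max_left _ _).trans (Nat.le_add_left _ _)

lemma Formula.three_le_length (φ : Formula) : 3 ≤ φ.length := by
  induction φ with
  | ltZero t =>
    have := (one_le_intLength _).trans t.intLength_const_le
    simp only [Formula.length]; omega
  | modZero t q =>
    simp only [Formula.length]; omega
  | and φ ψ h1 h2 => simp only [Formula.length]; omega
  | not φ h => simp only [Formula.length]; omega
  | ex y φ h => simp only [Formula.length]; omega
  | exGe c y φ h => simp only [Formula.length]; omega

/-- Determination with parameters bounded in terms of a length `n`. -/
def BoundedDetermined (n : ℕ) (P : Assignment → Prop) : Prop :=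
  ∃ (V : Finset Var) (H : Finset (Var →₀ ℤ)) (K m : ℕ), Determined V H K m P ∧ 0 < m ∧
    H.card ≤ 2 ^ 2 ^ n ∧ (∀ h ∈ H, ∀ x, (h x).natAbs ≤ 2 ^ 2 ^ n) ∧
    K ≤ 2 ^ 2 ^ 2 ^ n ∧ m ≤ 2 ^ 2 ^ 2 ^ n

lemma two_pow_le_two_pow {a b : ℕ} (h : a ≤ b) : 2 ^ a ≤ 2 ^ b :=
  Nat.pow_le_pow_right (by norm_num) h

lemma BoundedDetermined.mono {n n' : ℕ} {P : Assignment → Prop} (h : BoundedDetermined n P)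
    (hn : n ≤ n') : BoundedDetermined n' P := by
  obtain ⟨V, H, K, m, hP, hm, hH, hA, hK, hm'⟩ := h
  have h1 := two_pow_le_two_pow (two_pow_le_two_pow hn)
  have h2 := two_pow_le_two_pow h1
  exact ⟨V, H, K, m, hP, hm, hH.trans h1, fun h hh x => (hA h hh x).trans h1, hK.trans h2,
    hm'.trans h2⟩

lemma le_two_pow_two_pow {n : ℕ} : 2 ^ n ≤ 2 ^ 2 ^ n :=
  two_pow_le_two_pow Nat.lt_two_pow_self.le

lemma BoundedDetermined.and {n₁ n₂ : ℕ} {P Q : Assignment → Prop}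
    (h₁ : BoundedDetermined n₁ P) (h₂ : BoundedDetermined n₂ Q) :
    BoundedDetermined (n₁ + n₂ + 1) fun ν => P ν ∧ Q ν := by
  obtain ⟨V, H, K, m, hP, hm, hH, hA, hK, hm'⟩ := h₁.mono (Nat.le_add_right n₁ n₂)
  obtain ⟨V', H', K', m', hP', hmp, hH', hA', hK', hmp'⟩ := h₂.mono (Nat.le_add_left n₂ n₁)
  have e1 : 2 ^ 2 ^ (n₁ + n₂) * 2 ^ 2 ^ (n₁ + n₂) = 2 ^ 2 ^ (n₁ + n₂ + 1) := by
    rw [← pow_add, pow_succ]; ring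
  have e2 : 2 ^ 2 ^ 2 ^ (n₁ + n₂) * 2 ^ 2 ^ 2 ^ (n₁ + n₂) ≤ 2 ^ 2 ^ 2 ^ (n₁ + n₂ + 1) := by
    rw [← pow_add, ← mul_two, ← pow_succ]
    refine two_pow_le_two_pow (two_pow_le_two_pow ?_)
    exact Nat.pow_lt_pow_right (by norm_num) (Nat.lt_succ_self _)
  have t1 : 2 ≤ 2 ^ 2 ^ (n₁ + n₂) := Nat.le_self_pow (by positivity) 2
  have t2 := two_pow_le_two_pow (two_pow_le_two_pow (two_pow_le_two_pow
    (Nat.le_succ (n₁ + n₂))))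
  have t3 := two_pow_le_two_pow (two_pow_le_two_pow (Nat.le_succ (n₁ + n₂)))
  refine ⟨V ∪ V', H ∪ H', max K K', m * m', ?_, by positivity, ?_, ?_,
    (max_le hK hK').trans t2, (Nat.mul_le_mul hm' hmp').trans e2⟩
  · intro ν ν' a b
    exact And.imp
      (hP.mono Finset.subset_union_left Finset.subset_union_left (le_max_left _ _)
        (Dvd.intro _ rfl) ν ν' a b)
      (hP'.mono Finset.subset_union_right Finset.subset_union_right (le_max_right _ _)
        (Dvd.intro_left _ rfl) ν ν' a b)
  · refine (Finset.card_union_le _ _).trans ?_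
    nlinarith
  · intro h hh x
    rcases Finset.mem_union.1 hh with hh | hh
    · exact (hA h hh x).trans t3
    · exact (hA' h hh x).trans t3

lemma BoundedDetermined.not {n : ℕ} {P : Assignment → Prop} (h : BoundedDetermined n P) :
    BoundedDetermined n fun ν => ¬ P ν := by
  obtain ⟨V, H, K, m, hP, h⟩ := h
  exact ⟨V, H, K, m, hP.not, h⟩

/-- With `X = 2 ^ 2 ^ n`, raising `n` by `2` replaces `X` by `X ^ 4`. This covers the roughly
quadratic growth of forms and coefficients, and the factor `X! ≤ X ^ X` in the modulus, since `2 ^ X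
* X ^ X ≤ 2 ^ (X + X * X)`. -/
lemma BoundedDetermined.exGe {n c : ℕ} {P : Assignment → Prop} (h : BoundedDetermined n P)
    (hn : 3 ≤ n) (y : Var) (hc : c ≤ 2 ^ (n + 2)) :
    BoundedDetermined (n + 2) fun ν =>
      (c : ℕ∞) ≤ {k : ℤ | P (Function.update ν y k)}.encard := by
  obtain ⟨V, H, K, m, hP, hm, hH, hA, hK, hm'⟩ := h
  have hE : 2 ^ 2 ^ (n + 2) = (2 ^ 2 ^ n) ^ 4 := by rw [← pow_mul, pow_add]; norm_num
  have hX8 : 8 ≤ 2 ^ 2 ^ n := (two_pow_le_two_pow hn).trans le_two_pow_two_pow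
  have hnX : 2 ^ n ≤ 2 ^ 2 ^ n := le_two_pow_two_pow
  have hc4 : c ≤ 4 * 2 ^ n := hc.trans (by rw [pow_add]; omega)
  unfold BoundedDetermined
  rw [hE]
  generalize hXdef : 2 ^ 2 ^ n = X at *
  have hXY : X ≤ 2 ^ X := Nat.lt_two_pow_self.le
  have hX2 : X + 2 * X ^ 2 ≤ X ^ 4 := by
    have h1 : X ≤ X ^ 2 := Nat.le_self_pow two_ne_zero X
    calc X + 2 * X ^ 2 ≤ 3 * X ^ 2 := by omega
      _ ≤ X ^ 2 * X ^ 2 := Nat.mul_le_mul_right _ (by omega)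
      _ = X ^ 4 := by ring
  refine ⟨_, _, _, _, hP.exGe hm hA c y, by positivity, ?_, ?_, ?_, ?_⟩
  · refine (card_elimForms_le y H).trans (le_trans ?_ hX2)
    have := Nat.pow_le_pow_left hH 2
    omega
  · exact fun h hh x => (natAbs_elimForms_le hA h hh x).trans hX2
  · have hY : 2 ^ (8 * X) ≤ 2 ^ X ^ 4 := by
      refine two_pow_le_two_pow ?_
      have : X ^ 4 = X ^ 2 * X * X := by ring
      rw [this]
      exact Nat.mul_le_mul_right _ (by nlinarith)
    refine le_trans ?_ hY
    rw [mul_comm 8 X, pow_mul]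
    have hcY : c ≤ 4 * 2 ^ X := by omega
    generalize 2 ^ X = Y at *
    have hY4 : 4 ≤ Y := by omega
    calc K + X ^ 2 * (2 * (K + m * c)) ≤ Y + Y ^ 2 * (2 * (Y + Y * (4 * Y))) := by gcongr
      _ ≤ Y * Y ^ 3 + Y ^ 2 * (2 * (Y * Y + Y * (4 * Y))) := by
        gcongr
        · exact Nat.le_mul_of_pos_right _ (by positivity)
        · exact Nat.le_mul_of_pos_right _ (by omega)
      _ = 11 * Y ^ 4 := by ring
      _ ≤ 4 ^ 4 * Y ^ 4 := by gcongr; norm_num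
      _ ≤ Y ^ 4 * Y ^ 4 := by gcongr
      _ = Y ^ 8 := by ring
  · calc m * X.factorial ≤ 2 ^ X * X ^ X := Nat.mul_le_mul hm' (Nat.factorial_le_pow X)
      _ ≤ 2 ^ X * (2 ^ X) ^ X := by gcongr
      _ = 2 ^ (X + X * X) := by rw [pow_add, pow_mul]
      _ ≤ 2 ^ X ^ 4 := two_pow_le_two_pow (by nlinarith)

lemma Formula.boundedDetermined (φ : Formula) : BoundedDetermined φ.length φ.Sat := by
  induction φ with
  | ltZero t =>
    have h1 : t.length ≤ (Formula.ltZero t).length := Nat.le_add_right _ _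
    refine ⟨∅, {t.coeff}, t.const.natAbs, 1, ?_, one_pos, ?_, ?_, ?_, Nat.one_le_two_pow⟩
    · intro ν ν' _ h hlt
      have := h t.coeff (by simp)
      simp only [Formula.Sat, eval_eq_formEval] at hlt ⊢
      unfold ClampEq at this
      omega
    · simpa using Nat.one_le_two_pow
    · intro h hh x
      rw [Finset.mem_singleton.1 hh]
      exact (t.natAbs_coeff_lt x).le.trans ((two_pow_le_two_pow h1).trans le_two_pow_two_pow)
    · exact (natAbs_lt_two_pow_intLength _).le.trans
        ((two_pow_le_two_pow (t.intLength_const_le.trans h1)).trans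
          (le_two_pow_two_pow.trans (two_pow_le_two_pow le_two_pow_two_pow)))
  | modZero t q =>
    refine ⟨t.coeff.support, ∅, 0, q, ?_, q.pos, by simp, by simp, by simp, ?_⟩
    · intro ν ν' h _ hd
      simp only [Formula.Sat, eval_eq_formEval] at hd ⊢
      have := dvd_sub hd (dvd_formEval_sub h)
      rwa [add_sub_right_comm, sub_sub_cancel] at this
    · refine (Nat.lt_size_self (q : ℕ)).le.trans ?_
      refine (two_pow_le_two_pow ?_).trans
          (le_two_pow_two_pow.trans (two_pow_le_two_pow le_two_pow_two_pow))
      exact (le_max_right 1 _).trans (Nat.le_add_left _ _)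
  | and φ ψ h1 h2 => exact h1.and h2
  | not φ h => exact h.not.mono (Nat.le_succ _)
  | ex y φ h =>
    have := h.exGe φ.three_le_length y (c := 1) Nat.one_le_two_pow
    simp only [Nat.cast_one, Set.one_le_encard_iff_nonempty] at this
    exact this
  | exGe c y φ h =>
    have hlen : (Formula.exGe c y φ).length = intLength c + φ.length + 1 + 2 := rfl
    rw [hlen]
    have h3 := φ.three_le_length
    -- The binary length of `c` is part of the formula length, so enlarging the bound first makes
    -- the threshold admissible.
    refine (h.mono (by omega)).exGe (by omega) y ?_
    refine le_trans (by omega) ((natAbs_lt_two_pow_intLength c).le.trans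
      (two_pow_le_two_pow (by omega)))

end ThresholdPA

/-! ### Assembling the bounds -/

open ThresholdPA in
theorem mainTheorem6 :
    ∃ C : ℕ, ∀ φ : ThresholdPA.Formula, ∃ Φ : ThresholdPA.Formula,
      Φ.QuantifierFree ∧ Φ.Equivalent φ ∧
      Φ.linTerms.card ≤ 2 ^ 2 ^ 2 ^ (C * φ.length ^ 2) ∧
      ThresholdPA.termsNorm Φ.linTerms ≤ 2 ^ 2 ^ 2 ^ (C * φ.length ^ 2) ∧
      ThresholdPA.termsNorm Φ.homTerms ≤ 2 ^ 2 ^ 2 ^ (C * φ.length ^ 2) ∧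
      ThresholdPA.natsNorm Φ.moduli ≤ 2 ^ 2 ^ 2 ^ (C * φ.length ^ 2) ∧
      Φ.homTerms.card ≤ 2 ^ 2 ^ (C * φ.length ^ 2) ∧
      Φ.moduli.card ≤ φ.length := by
  -- The induction gives exponent `φ.length`, and the passage to a formula costs at most `2` more;
  -- `n + 2 ≤ 2 * n ^ 2` leaves ample room.
  refine ⟨2, fun φ => ?_⟩
  obtain ⟨V, H, K, m, hP, hm, hH, hA, hK, hm'⟩ := φ.boundedDetermined
  obtain ⟨Φ, hqf, hlin, hmod, hsat⟩ := hP.exists_formula hm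
  have h3 := φ.three_le_length
  refine ⟨Φ, hqf, hsat, ?_⟩
  have hhom : Φ.homTerms ⊆ H.image fun h => ⟨h, 0⟩ := by
    intro t ht
    obtain ⟨u, hu, rfl⟩ := Finset.mem_image.1 ht
    exact Finset.mem_image_of_mem _ (mem_boxTerms.1 (hlin hu)).1
  have hhomcard : Φ.homTerms.card ≤ H.card := (Finset.card_le_card hhom).trans Finset.card_image_le
  -- All moduli have been merged into `m`, and every formula has length at least `3`.
  have hmodcard : Φ.moduli.card ≤ 2 := (Finset.card_le_card hmod).trans Finset.card_le_two
  have hlincard := (Finset.card_le_card hlin).trans (card_boxTerms_le H K)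
  generalize φ.length = n at *
  have hn2 : n + 2 ≤ 2 * n ^ 2 := by nlinarith
  have hX8 : 8 ≤ 2 ^ 2 ^ n := (two_pow_le_two_pow h3).trans le_two_pow_two_pow
  have hE : 2 ^ (4 * 2 ^ 2 ^ n) ≤ 2 ^ 2 ^ 2 ^ (2 * n ^ 2) := by
    refine two_pow_le_two_pow (le_trans ?_ (two_pow_le_two_pow (two_pow_le_two_pow hn2)))
    rw [pow_add 2 n 2, pow_mul]
    generalize 2 ^ 2 ^ n = X at *
    calc 4 * X ≤ X ^ 3 * X := Nat.mul_le_mul_right _ (by nlinarith [Nat.pow_le_pow_left hX8 3])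
      _ = X ^ 2 ^ 2 := by ring
  have hX : 2 ^ 2 ^ n ≤ 2 ^ 2 ^ (2 * n ^ 2) := two_pow_le_two_pow (two_pow_le_two_pow (by omega))
  have hY : 2 ^ 2 ^ 2 ^ n ≤ 2 ^ 2 ^ 2 ^ (2 * n ^ 2) := two_pow_le_two_pow hX
  have hXY : 2 ^ 2 ^ n ≤ 2 ^ 2 ^ 2 ^ n := Nat.lt_two_pow_self.le
  have hKE : 2 ^ 2 ^ n * (2 * K + 3) ≤ 2 ^ 2 ^ 2 ^ (2 * n ^ 2) := by
    refine le_trans ?_ hE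
    rw [mul_comm 4, pow_mul]
    generalize 2 ^ 2 ^ n = X at *
    generalize 2 ^ X = Y at *
    calc X * (2 * K + 3) ≤ Y * (Y * Y ^ 2) := Nat.mul_le_mul hXY (by nlinarith)
      _ = Y ^ 4 := by ring
  have hK1 : K + 1 ≤ 2 ^ 2 ^ 2 ^ (2 * n ^ 2) := by nlinarith
  have hcoeff : ∀ t : LinTerm, t.coeff ∈ H →
      (t.coeff.support.sup fun x => (t.coeff x).natAbs) ≤ 2 ^ 2 ^ 2 ^ (2 * n ^ 2) :=
    fun t ht => Finset.sup_le fun x _ => (hA _ ht x).trans (hXY.trans hY)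
  refine ⟨hlincard.trans ((Nat.mul_le_mul_right _ hH).trans hKE), Finset.sup_le fun t ht => ?_,
    Finset.sup_le fun t ht => ?_, Finset.sup_le fun q hq => ?_, hhomcard.trans (hH.trans hX),
    by omega⟩
  · obtain ⟨h1, h2⟩ := mem_boxTerms.1 (hlin ht)
    rw [Finset.mem_Icc] at h2
    exact max_le (hcoeff t h1) (le_trans (by omega) hK1)
  · obtain ⟨h, hh, rfl⟩ := Finset.mem_image.1 (hhom ht)
    exact max_le (hcoeff ⟨h, 0⟩ hh) (by simp)
  · rcases Finset.mem_insert.1 (hmod hq) with rfl | h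
    · exact Nat.one_le_two_pow
    · rw [Finset.mem_singleton.1 h]
      exact hm'.trans hY
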